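/- Let $R$ be an associative ring with identity and let $n$ be a positive integer. Let $\mathcal E_n$ be the category whose objects are the right $R$-modules $M$ with a fixed chain of submodules $0=M^{(0)}\le M^{(1)}\le\dots\le M^{(n)}=M$ and whose morphisms $M\to N$ are the right $R$-module morphisms $f\colon M\to N$ with $f(M^{(i)})\subseteq N^{(i)}$ for every $i=1,\dots,n$. Such an $f$ induces morphisms $f_i\colon M^{(i)}/M^{(i-1)}\to N^{(i)}/N^{(i-1)}$ on the factor modules, $i=1,\dots,n$. Direct sums in $\mathcal E_n$ are formed termwise: $(\bigoplus_k M_k)^{(i)}=\bigoplus_k M_k^{(i)}$. For objects $M,N$ of $\mathcal E_n$ and $i=1,\dots,n$, write $[M]_{i,m}=[N]_{i,m}$ (same $i$-th monogeny class) if there exist morphisms $f\colon M\to N$ and $g\colon N\to M$ in $\mathcal E_n$ such that $f_i$ and $g_i$ are both injective, and write $[M]_{i,e}=[N]_{i,e}$ (same $i$-th epigeny class) if there exist morphisms $f\colon M\to N$ and $g\colon N\to M$ in $\mathcal E_n$ such that $f_i$ and $g_i$ are both surjective. A module is called uniserial if its lattice of submodules is linearly ordered by inclusion; the zero module is uniserial.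 Theorem. Let $M_1,\dots,M_r,N_1,\dots,N_s$ be nonzero objects of $\mathcal E_n$ all of whose factor modules $U_k^{(i)}=M_k^{(i)}/M_k^{(i-1)}$ ($k=1,\dots,r$) and $V_l^{(i)}=N_l^{(i)}/N_l^{(i-1)}$ ($l=1,\dots,s$), $i=1,\dots,n$, are uniserial (possibly zero). For $i=1,\dots,n$ put $$X_i=\{k\mid 1\le k\le r,\ U_k^{(i)}\ne 0\},\qquad Y_i=\{l\mid 1\le l\le s,\ V_l^{(i)}\neq 0\}.$$ Then $\bigoplus_{k=1}^r M_k\cong\bigoplus_{l=1}^s N_l$ in $\mathcal E_n$ if and only if there exist $2n$ bijections $\varphi_{i,a}\colon X_i\to Y_i$ ($i=1,\dots,n$, $a=m,e$) such that $[M_k]_{i,a}=[N_{\varphi_{i,a}(k)}]_{i,a}$ for every $i=1,\dots,n$, every $a=m,e$ and every $k\in X_i$. -/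

import Mathlib

open CategoryTheory

universe v u

/-- A module is uniserial if its lattice of submodules is linearly ordered by inclusion
(the zero module is uniserial). -/
def IsUniserial (S : Type u) [Ring S] (M : Type v) [AddCommGroup M] [Module S M] : Prop :=
  ∀ A B : Submodule S M, A ≤ B ∨ B ≤ A

/-- An `S`-module with a fixed chain of submodules
`0 = chain 0 ≤ chain 1 ≤ ... ≤ chain n = M`.
For right modules over a ring `R` one takes `S = Rᵐᵒᵖ`. -/
structure ChainModule (S : Type u) [Ring S] (n : ℕ) where
  carrier : Type v
  [addCommGroup : AddCommGroup carrier]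
  [module : Module S carrier]
  chain : Fin (n + 1) → Submodule S carrier
  chain_mono : Monotone chain
  chain_zero : chain 0 = ⊥
  chain_last : chain (Fin.last n) = ⊤

namespace ChainModule

attribute [instance] ChainModule.addCommGroup ChainModule.module

variable {S : Type u} [Ring S] {n : ℕ}

/-- A morphism is an `S`-linear map carrying the `j`-th submodule of the source into the `j`-th
submodule of the target, for every `j`. -/
@[ext]
structure Hom (M N : ChainModule.{v} S n) where
  toLinearMap : M.carrier →ₗ[S] N.carrier
  map_mem : ∀ (j : Fin (n + 1)), ∀ x ∈ M.chain j, toLinearMap x ∈ N.chain j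

instance : Category (ChainModule.{v} S n) where
  Hom M N := Hom M N
  id M := ⟨LinearMap.id, fun _ _ hx => hx⟩
  comp f g := ⟨g.toLinearMap ∘ₗ f.toLinearMap, fun j x hx => g.map_mem j _ (f.map_mem j x hx)⟩

/-- The factor module `M^(i) / M^(i-1)`. The `n` factors are indexed by `Fin n`, the index
`i : Fin n` standing for the quotient of `chain (i + 1)` by `chain i`. -/
abbrev Factor (M : ChainModule.{v} S n) (i : Fin n) : Type v :=
  M.chain i.succ ⧸ (M.chain i.castSucc).submoduleOf (M.chain i.succ)

/-- The `i`-th induced morphism between the `i`-th factor modules. -/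
def factorMap {M N : ChainModule.{v} S n} (f : M ⟶ N) (i : Fin n) :
    M.Factor i →ₗ[S] N.Factor i :=
  Submodule.mapQ _ _
    (Hom.toLinearMap f |>.restrict (fun x hx => Hom.map_mem f i.succ x hx))
    (fun x hx => Hom.map_mem f i.castSucc x.1 hx)

/-- `M` and `N` belong to the same `i`-th monogeny class. -/
def SameMonogenyClass (i : Fin n) (M N : ChainModule.{v} S n) : Prop :=
  ∃ (f : M ⟶ N) (g : N ⟶ M),
    Function.Injective (factorMap f i) ∧ Function.Injective (factorMap g i)

/-- `M` and `N` belong to the same `i`-th epigeny class. -/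
def SameEpigenyClass (i : Fin n) (M N : ChainModule.{v} S n) : Prop :=
  ∃ (f : M ⟶ N) (g : N ⟶ M),
    Function.Surjective (factorMap f i) ∧ Function.Surjective (factorMap g i)

/-- The finite direct sum: the module `⨁ M_k` (tuples, the index set being finite) with the
chain whose `j`-th term is `⨁ M_k^(j)`. -/
def directSum {r : ℕ} (M : Fin r → ChainModule.{v} S n) : ChainModule.{v} S n where
  carrier := ∀ k, (M k).carrier
  chain j := Submodule.pi Set.univ (fun k => (M k).chain j)
  chain_mono _ _ h _ hx k hk := (M k).chain_mono h (hx k hk)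
  chain_zero := by
    ext x
    simp [chain_zero, funext_iff]
  chain_last := by
    ext x
    simp [chain_last]

/-- The set of indices `k` such that the `i`-th factor module of `M k` is nonzero. -/
def nonzeroFactorIndices {r : ℕ} (M : Fin r → ChainModule.{v} S n) (i : Fin n) : Set (Fin r) :=
  {k | Nontrivial ((M k).Factor i)}

end ChainModule

/-!
An isomorphism of the direct sums of the `M k` and of the `N l` induces, for each `i`, an
isomorphism of the `i`-th factors. These thus form one module `E` decomposed both as the direct sum
of the `i`-th factors `U k` of the `M k` and as that of the `i`-th factors `V l` of the `N l`, all
of them uniserial. In the lattice of submodules of `E`, the images of the `U k` are independent and the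
kernels of the projections to the `V l` have zero intersection, and the intervals below the former
and above the latter are chains. Counting uniform dimension in this modular lattice gives Hall's
condition for the relation "the entry `U k ⟶ V l` is injective" (`exists_injective_inf_eq_bot`);
the dual lattice treats surjective entries. This matches the nonzero `U k` injectively with the
`V l`, compatibly with the preorder "there is a morphism which is injective on the `i`-th factors".
The inverse isomorphism gives an injection back, and as the index sets are finite, the orbits of
the composite are cycles, along which all the preorder relations become equivalences
(`exists_equiv_of_injective_of_le`).

Conversely, the morphisms that are not injective, respectively not surjective, on the nonzero `i`-th
factors form `2n` completely prime ideals (`ChainModule.factorIdeals`), and by the five lemma an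
endomorphism of an object outside all the proper ones among them is invertible. So the maximal ones
among these ideals are the maximal ideals of the endomorphism ring, which is a product of division
rings modulo its Jacobson radical. Whether the ideal `p` is maximal at an object depends only on
the `p`-class of the object (`CompletelyPrimeFamily.IsTop.of_notMem`), so the given bijections match
the simple factors of the two direct sums modulo the radical. Lifting this matching gives matrices
in both directions whose products are invertible because they are the identity modulo the radical
(`CompletelyPrimeFamily.nonempty_iso_of_equiv`).
-/

/-! ### Uniform dimension in modular lattices and Hall's condition -/

section Lattice

variable {α κ l : Type*} [Lattice α] [IsModularLattice α] [BoundedOrder α]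

/-- An independent family of nonzero elements has at most as many members as a family `H` of
elements, with chains above them, whose infimum meets the independent family trivially. By
induction on the second family: if `H j` meets all members of the first, these can be shrunk below
`H j`; otherwise some `A k₀` is disjoint from `H j`, and the `A k` with `k ≠ k₀` are replaced with
the nonzero elements `(A k ⊔ A k₀) ⊓ H j`. -/
theorem card_le_card_of_supIndep_of_chain_above (N : Finset l) (H : l → α)
    (hH : ∀ j ∈ N, ∀ x y, H j ≤ x → H j ≤ y → x ≤ y ∨ y ≤ x) (S : Finset κ) (A : κ → α)
    (hA : S.SupIndep A) (hA₀ : ∀ k ∈ S, A k ≠ ⊥) (hAH : S.sup A ⊓ N.inf H = ⊥) :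
    S.card ≤ N.card := by
  classical
  induction N using Finset.induction generalizing S A with
  | empty =>
    rw [Finset.inf_empty, inf_top_eq] at hAH
    have : S = ∅ := Finset.eq_empty_of_forall_notMem fun k hk =>
      hA₀ k hk (le_bot_iff.1 (hAH ▸ Finset.le_sup hk))
    simp [this]
  | insert j N hj ih =>
    rw [Finset.card_insert_of_notMem hj]
    have hH' : ∀ j ∈ N, ∀ x y, H j ≤ x → H j ≤ y → x ≤ y ∨ y ≤ x :=
      fun i hi => hH i (Finset.mem_insert_of_mem hi)
    have hHj := hH j (Finset.mem_insert_self j N)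
    rw [Finset.inf_insert, ← inf_assoc] at hAH
    by_cases h : ∀ k ∈ S, A k ⊓ H j ≠ ⊥
    · refine (ih hH' S (fun k => A k ⊓ H j) (hA.mono fun k _ => inf_le_left) h ?_).trans
        (Nat.le_succ _)
      refine le_bot_iff.1 (le_trans (inf_le_inf_right _ ?_) hAH.le)
      exact Finset.sup_le fun k hk => inf_le_inf_right _ (Finset.le_sup hk)
    · push Not at h
      obtain ⟨k₀, hk₀, h₀⟩ := h
      rw [← Finset.card_erase_add_one hk₀]
      refine Nat.succ_le_succ (ih hH' (S.erase k₀) (fun k => (A k ⊔ A k₀) ⊓ H j) ?_ ?_ ?_)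
      · intro t ht k hk hkt
        have hkS := Finset.mem_erase.1 hk
        have hd : A k ⊓ (t.sup A ⊔ A k₀) = ⊥ := by
          have := hA (t := insert k₀ t)
            (Finset.insert_subset hk₀ (ht.trans (Finset.erase_subset _ _))) hkS.2
            (by simp [hkS.1, hkt])
          rw [Finset.sup_insert, sup_comm] at this
          exact this.eq_bot
        have hle : t.sup (fun k => (A k ⊔ A k₀) ⊓ H j) ≤ t.sup A ⊔ A k₀ :=
          Finset.sup_le fun i hi =>
            inf_le_left.trans (sup_le_sup_right (Finset.le_sup hi) _)
        rw [disjoint_iff_inf_le]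
        calc (A k ⊔ A k₀) ⊓ H j ⊓ t.sup (fun k => (A k ⊔ A k₀) ⊓ H j)
            ≤ ((A k₀ ⊔ A k) ⊓ (t.sup A ⊔ A k₀)) ⊓ H j := by
              rw [sup_comm (A k₀)]
              exact le_inf (le_inf (inf_le_left.trans inf_le_left) (inf_le_right.trans hle))
                (inf_le_left.trans inf_le_right)
          _ = A k₀ ⊓ H j := by
              rw [sup_inf_assoc_of_le (A k) (le_sup_right : A k₀ ≤ t.sup A ⊔ A k₀), hd,
                sup_bot_eq]
          _ ≤ ⊥ := h₀.le
      · intro k hk hbot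
        obtain ⟨hne, hkS⟩ := Finset.mem_erase.1 hk
        have hdis : A k ⊓ A k₀ = ⊥ := (hA.pairwiseDisjoint hkS hk₀ hne).eq_bot
        rcases hHj (A k ⊔ H j) (A k₀ ⊔ H j) le_sup_right le_sup_right with hle | hle
        · apply hA₀ k hkS
          have h1 : A k ≤ (A k₀ ⊔ H j) ⊓ (A k ⊔ A k₀) :=
            le_inf (le_sup_left.trans hle) le_sup_left
          rw [sup_inf_assoc_of_le (H j) (le_sup_right : A k₀ ≤ A k ⊔ A k₀), inf_comm (H j), hbot,
            sup_bot_eq] at h1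
          rw [← hdis, inf_eq_left.2 h1]
        · apply hA₀ k₀ hk₀
          have h1 : A k₀ ≤ (A k ⊔ H j) ⊓ (A k ⊔ A k₀) :=
            le_inf (le_sup_left.trans hle) le_sup_right
          rw [sup_inf_assoc_of_le (H j) (le_sup_left : A k ≤ A k ⊔ A k₀), inf_comm (H j), hbot,
            sup_bot_eq] at h1
          rw [← hdis, inf_eq_right.2 h1]
      · refine le_bot_iff.1 (le_trans (inf_le_inf_right _ ?_) hAH.le)
        refine Finset.sup_le fun k hk => inf_le_inf_right _ (sup_le ?_ (Finset.le_sup hk₀))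
        exact Finset.le_sup (Finset.mem_of_mem_erase hk)

/-- The nonzero members of an independent family of elements with chains below them can be matched
injectively with disjoint members of a family with infimum `⊥` and chains above its members. -/
theorem exists_injective_inf_eq_bot [Fintype κ] [Fintype l] (D : κ → α) (H : l → α)
    (hD : Finset.univ.SupIndep D) (hDc : ∀ k x y, x ≤ D k → y ≤ D k → x ≤ y ∨ y ≤ x)
    (hH : Finset.univ.inf H = ⊥) (hHc : ∀ j x y, H j ≤ x → H j ≤ y → x ≤ y ∨ y ≤ x) :
    ∃ σ : {k // D k ≠ ⊥} → l, Function.Injective σ ∧ ∀ k, D k.1 ⊓ H (σ k) = ⊥ := by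
  classical
  have key : ∀ S : Finset {k // D k ≠ ⊥}, S.card ≤
      (S.biUnion fun k => Finset.univ.filter fun j => D k.1 ⊓ H j = ⊥).card := by
    intro S
    set N := S.biUnion fun k => Finset.univ.filter fun j => D k.1 ⊓ H j = ⊥ with hN
    -- The part of `D k` lying below all `H j` with `j ∉ N` is nonzero, as `[⊥, D k]` is a chain.
    have hne : ∀ k ∈ S, D k.1 ⊓ Nᶜ.inf H ≠ ⊥ := by
      intro k hk
      have : ∀ T ⊆ Nᶜ, D k.1 ⊓ T.inf H ≠ ⊥ := by
        intro T
        induction T using Finset.induction with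
        | empty => intro _; simpa using k.2
        | insert j T hj ih =>
          intro hT
          have hj' : D k.1 ⊓ H j ≠ ⊥ := by
            intro h
            refine Finset.mem_compl.1 (hT (Finset.mem_insert_self j T)) ?_
            rw [hN, Finset.mem_biUnion]
            exact ⟨k, hk, by simpa using h⟩
          have hT' := ih ((Finset.subset_insert j T).trans hT)
          rw [Finset.inf_insert, inf_inf_distrib_left]
          rcases hDc k.1 _ _ (inf_le_left : D k.1 ⊓ H j ≤ _)
            (inf_le_left : D k.1 ⊓ T.inf H ≤ _) with h | h
          · rwa [inf_eq_left.2 h]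
          · rwa [inf_eq_right.2 h]
      exact this _ subset_rfl
    refine card_le_card_of_supIndep_of_chain_above N H (fun j _ => hHc j) S
      (fun k => D k.1 ⊓ Nᶜ.inf H) ?_ hne ?_
    · have h1 : S.SupIndep (D ∘ Subtype.val) := by
        exact (Finset.supIndep_map (g := Function.Embedding.subtype _)).1
          (hD.subset (Finset.subset_univ _))
      exact h1.mono fun k _ => inf_le_left
    · have h1 : N.inf H ⊓ Nᶜ.inf H = ⊥ := by
        rw [← Finset.inf_union, Finset.union_compl, hH]
      rw [inf_comm, ← le_bot_iff]
      exact (inf_le_inf_left _ (Finset.sup_le fun k _ => inf_le_right)).trans h1.le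
  obtain ⟨σ, hσ, h⟩ := (Finset.all_card_le_biUnion_card_iff_exists_injective _).1 key
  exact ⟨σ, hσ, fun k => by simpa using h k⟩

end Lattice

/-! ### Matching in both directions along a preorder -/

/-- A Cantor–Bernstein argument for finite sets: along a cycle of `τ ∘ σ` all elements are
equivalent for the preorder `le`, so `σ` itself is the required bijection. -/
theorem exists_equiv_of_injective_of_le {X Y Z : Type*} [Finite X] [Finite Y]
    (le : Z → Z → Prop) (trans : ∀ {x y z}, le x y → le y z → le x z) (a : X → Z) (b : Y → Z)
    {σ : X → Y} (hσ : Function.Injective σ) (hσ' : ∀ k, le (a k) (b (σ k)))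
    {τ : Y → X} (hτ : Function.Injective τ) (hτ' : ∀ j, le (b j) (a (τ j))) :
    ∃ e : X ≃ Y, ∀ k, le (a k) (b (e k)) ∧ le (b (e k)) (a k) := by
  have hcard : Nat.card X = Nat.card Y :=
    le_antisymm (Nat.card_le_card_of_injective σ hσ) (Nat.card_le_card_of_injective τ hτ)
  have hbij : Function.Bijective σ := (Nat.bijective_iff_injective_and_card σ).2 ⟨hσ, hcard⟩
  let p : Equiv.Perm X := Equiv.ofBijective (τ ∘ σ)
    (Finite.injective_iff_bijective.1 (hτ.comp hσ))
  have hp : ∀ k, p k = τ (σ k) := fun _ => rfl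
  have step : ∀ k (m : ℕ), le (b (σ k)) (a ((p ^ (m + 1)) k)) := by
    intro k m
    induction m with
    | zero => simpa [hp] using hτ' (σ k)
    | succ m ih =>
      rw [pow_succ', Equiv.Perm.mul_apply, hp]
      exact trans (trans ih (hσ' _)) (hτ' _)
  refine ⟨Equiv.ofBijective σ hbij, fun k => ⟨hσ' k, ?_⟩⟩
  obtain ⟨m, hm, h1⟩ := (isOfFinOrder_of_finite p).exists_pow_eq_one
  obtain ⟨m, rfl⟩ := Nat.exists_eq_succ_of_ne_zero hm.ne'
  have := step k m
  rwa [← Nat.succ_eq_add_one, h1] at this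

/-! ### Completely prime ideals detecting invertibility -/

theorem Ideal.isUnit_of_sub_one_mem_jacobson {A : Type*} [Ring A] {r : A}
    (h : r - 1 ∈ Ideal.jacobson (⊥ : Ideal A)) : IsUnit r := by
  have hleft : ∀ r : A, r - 1 ∈ Ideal.jacobson (⊥ : Ideal A) → ∃ s, s * r = 1 := by
    intro r hr
    obtain ⟨s, hs⟩ := Ideal.exists_mul_sub_mem_of_sub_one_mem_jacobson r hr
    exact ⟨s, sub_eq_zero.1 ((Submodule.mem_bot A).1 hs)⟩
  obtain ⟨s, hs⟩ := hleft r h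
  obtain ⟨w, hw⟩ := hleft s (by
    have : s - 1 = -s * (r - 1) := by rw [mul_sub, neg_mul, hs]; noncomm_ring
    rw [this]
    exact Ideal.mul_mem_left _ _ h)
  have hwr : w = r := by
    calc w = w * (s * r) := by rw [hs, mul_one]
      _ = r := by rw [← mul_assoc, hw, one_mul]
  exact ⟨⟨r, s, by rw [← hwr]; exact hw, hs⟩, rfl⟩

section PrimeFamily

variable {C : Type*} [Category C] [Preadditive C]

/-- A family, indexed by `ι`, of completely prime ideals on the full subcategory of `C` spanned by
the objects `X a`, which jointly detect invertibility of endomorphisms. Such an ideal may contain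
the identity of some of the objects; for those objects it is the improper ideal and plays no role
in detecting isomorphisms. -/
structure CompletelyPrimeFamily {κ : Type*} (X : κ → C) (ι : Type*) where
  ideal : ι → ∀ a b, AddSubgroup (X a ⟶ X b)
  comp_mem_iff {p : ι} {a b c : κ} (f : X a ⟶ X b) (g : X b ⟶ X c) :
    f ≫ g ∈ ideal p a c ↔ f ∈ ideal p a b ∨ g ∈ ideal p b c
  isIso_of_forall {a : κ} (f : X a ⟶ X a) :
    (∀ p, 𝟙 (X a) ∉ ideal p a a → f ∉ ideal p a a) → IsIso f

namespace CompletelyPrimeFamily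

variable {κ ι : Type*} {X : κ → C} (I : CompletelyPrimeFamily X ι)

theorem comp_mem_left {p : ι} {a b c : κ} {f : X a ⟶ X b} (hf : f ∈ I.ideal p a b)
    (g : X b ⟶ X c) : f ≫ g ∈ I.ideal p a c :=
  (I.comp_mem_iff f g).2 (Or.inl hf)

theorem comp_mem_right {p : ι} {a b c : κ} (f : X a ⟶ X b) {g : X b ⟶ X c}
    (hg : g ∈ I.ideal p b c) : f ≫ g ∈ I.ideal p a c :=
  (I.comp_mem_iff f g).2 (Or.inr hg)

theorem comp_notMem {p : ι} {a b c : κ} {f : X a ⟶ X b} {g : X b ⟶ X c}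
    (hf : f ∉ I.ideal p a b) (hg : g ∉ I.ideal p b c) : f ≫ g ∉ I.ideal p a c :=
  fun h => ((I.comp_mem_iff f g).1 h).elim hf hg

theorem notMem_of_sub_mem {p : ι} {a b : κ} {f g : X a ⟶ X b} (h : f - g ∈ I.ideal p a b)
    (hg : g ∉ I.ideal p a b) : f ∉ I.ideal p a b := by
  intro hf
  have := sub_mem hf h
  rw [sub_sub_cancel] at this
  exact hg this

section IsTop

variable [LinearOrder ι]

/-- The index `p` is top at `a` if the `p`-th ideal of `End (X a)` is maximal among the proper
ideals of the family, and `p` is the least index giving this ideal. Thus the top indices enumerate,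
without repetition, the maximal ideals of `End (X a)`. -/
def IsTop (p : ι) (a : κ) : Prop :=
  𝟙 (X a) ∉ I.ideal p a a ∧ ∀ q, 𝟙 (X a) ∉ I.ideal q a a →
    I.ideal p a a ≤ I.ideal q a a → I.ideal q a a ≤ I.ideal p a a ∧ p ≤ q

variable {I}

theorem exists_isTop [Finite ι] {q : ι} {a : κ} (hq : 𝟙 (X a) ∉ I.ideal q a a) :
    ∃ p, I.IsTop p a ∧ I.ideal q a a ≤ I.ideal p a a := by
  obtain ⟨m, ⟨hm1, hm2⟩, hmax⟩ := Set.Finite.exists_maximalFor (fun p => I.ideal p a a)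
    {p | 𝟙 (X a) ∉ I.ideal p a a ∧ I.ideal q a a ≤ I.ideal p a a} (Set.toFinite _)
    ⟨q, hq, le_rfl⟩
  obtain ⟨p, hp, hmin⟩ := Set.exists_min_image {p | I.ideal p a a = I.ideal m a a} id
    (Set.toFinite _) ⟨m, rfl⟩
  have hp : I.ideal p a a = I.ideal m a a := hp
  refine ⟨p, ⟨by rwa [hp], fun r hr hpr => ?_⟩, by rwa [hp]⟩
  rw [hp] at hpr ⊢
  have hrm := hmax ⟨hr, hm2.trans hpr⟩ hpr
  exact ⟨hrm, hmin r (le_antisymm hrm hpr)⟩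

theorem isIso_of_forall_isTop [Finite ι] {a : κ} (f : X a ⟶ X a)
    (h : ∀ p, I.IsTop p a → f ∉ I.ideal p a a) : IsIso f :=
  I.isIso_of_forall f fun q hq hf => by
    obtain ⟨p, hp, hqp⟩ := exists_isTop (I := I) hq
    exact h p hp (hqp hf)

theorem IsTop.exists_mem_notMem {p q : ι} {a : κ} (hp : I.IsTop p a) (hq : I.IsTop q a)
    (hqp : q ≠ p) : ∃ x, x ∈ I.ideal q a a ∧ x ∉ I.ideal p a a := by
  by_contra! h
  have h1 := hq.2 p hp.1 h
  exact hqp (le_antisymm h1.2 (hp.2 q hq.1 h1.1).2)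

/-- The product of elements separating the `p`-th ideal from each of the other top ideals lies in
all of these and, by complete primeness, not in the `p`-th one. -/
theorem IsTop.exists_pure [Finite ι] {p : ι} {a : κ} (hp : I.IsTop p a) :
    ∃ e, e ∉ I.ideal p a a ∧ ∀ q, I.IsTop q a → q ≠ p → e ∈ I.ideal q a a := by
  classical
  have := Fintype.ofFinite ι
  have key : ∀ s : Finset ι,
      ∃ e, e ∉ I.ideal p a a ∧ ∀ q ∈ s, I.IsTop q a → q ≠ p → e ∈ I.ideal q a a := by
    intro s
    induction s using Finset.induction with
    | empty => exact ⟨𝟙 _, hp.1, by simp⟩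
    | insert r s _ ih =>
      obtain ⟨e, he, hes⟩ := ih
      by_cases hr : I.IsTop r a ∧ r ≠ p
      · obtain ⟨x, hxr, hxp⟩ := hp.exists_mem_notMem hr.1 hr.2
        refine ⟨x ≫ e, I.comp_notMem hxp he, fun q hq hqt hqp => ?_⟩
        rcases Finset.mem_insert.1 hq with rfl | hq
        · exact I.comp_mem_left hxr e
        · exact I.comp_mem_right x (hes q hq hqt hqp)
      · refine ⟨e, he, fun q hq hqt hqp => ?_⟩
        rcases Finset.mem_insert.1 hq with rfl | hq
        · exact absurd ⟨hqt, hqp⟩ hr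
        · exact hes q hq hqt hqp
  obtain ⟨e, he, h⟩ := key Finset.univ
  exact ⟨e, he, fun q => h q (Finset.mem_univ q)⟩

/-- Modulo a top ideal, `End (X a)` is a division ring: adding to `x` a suitable element of the
ideal gives an element outside all top ideals, that is, a unit. -/
theorem IsTop.exists_inverse [Finite ι] {p : ι} {a : κ} (hp : I.IsTop p a) {x : X a ⟶ X a}
    (hx : x ∉ I.ideal p a a) : ∃ y : X a ⟶ X a, x ≫ y - 𝟙 (X a) ∈ I.ideal p a a := by
  classical
  have := Fintype.ofFinite ι
  choose e he hpure using fun q : {q // I.IsTop q a} => q.2.exists_pure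
  let s : Finset {q // I.IsTop q a} := Finset.univ.filter fun q => x ∈ I.ideal q.1 a a
  let z : X a ⟶ X a := ∑ q ∈ s, e q
  have hz : z ∈ I.ideal p a a := by
    refine sum_mem fun q hq => hpure q p hp ?_
    rintro rfl
    exact hx (Finset.mem_filter.1 hq).2
  have : IsIso (x + z) := by
    refine isIso_of_forall_isTop (I := I) _ fun t ht hmem => ?_
    by_cases hxt : x ∈ I.ideal t a a
    · have hts : (⟨t, ht⟩ : {q // I.IsTop q a}) ∈ s :=
        Finset.mem_filter.2 ⟨Finset.mem_univ _, hxt⟩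
      have hzt : z ∈ I.ideal t a a := (add_mem_cancel_left hxt).1 hmem
      rw [show z = _ from (Finset.add_sum_erase s e hts).symm] at hzt
      refine he ⟨t, ht⟩ ((add_mem_cancel_right (sum_mem fun q hq => ?_)).1 hzt)
      exact hpure q t ht fun h => Finset.ne_of_mem_erase hq (Subtype.ext h.symm)
    · refine hxt ((add_mem_cancel_right (sum_mem fun q hq => hpure q t ht ?_)).1 hmem)
      rintro rfl
      exact hxt (Finset.mem_filter.1 hq).2
  refine ⟨inv (x + z), ?_⟩
  have hxz : x ≫ inv (x + z) - 𝟙 (X a) = -(z ≫ inv (x + z)) := by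
    rw [← IsIso.hom_inv_id (x + z), Preadditive.add_comp]
    abel
  rw [hxz]
  exact neg_mem (I.comp_mem_left hz _)

theorem IsTop.exists_inverse_of_notMem [Finite ι] {p : ι} {a b : κ} (hp : I.IsTop p a)
    {f : X a ⟶ X b} (hf : f ∉ I.ideal p a b) {g : X b ⟶ X a} (hg : g ∉ I.ideal p b a) :
    ∃ y : X a ⟶ X a, f ≫ g ≫ y - 𝟙 (X a) ∈ I.ideal p a a ∧
      (g ≫ y) ≫ f - 𝟙 (X b) ∈ I.ideal p b b := by
  obtain ⟨y, hy⟩ := hp.exists_inverse (I.comp_notMem hf hg)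
  rw [Category.assoc] at hy
  refine ⟨y, hy, ((I.comp_mem_iff f _).1 ?_).resolve_left hf⟩
  have : f ≫ ((g ≫ y) ≫ f - 𝟙 (X b)) = (f ≫ g ≫ y - 𝟙 (X a)) ≫ f := by simp
  rw [this]
  exact I.comp_mem_left hy f

/-- Being top at an object only depends on the class of the object with respect to the ideal. -/
theorem IsTop.of_notMem [Finite ι] {p : ι} {a b : κ} (hp : I.IsTop p a)
    {f : X a ⟶ X b} (hf : f ∉ I.ideal p a b) {g : X b ⟶ X a} (hg : g ∉ I.ideal p b a) :
    I.IsTop p b := by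
  obtain ⟨y, -, hgf⟩ := hp.exists_inverse_of_notMem hf hg
  refine ⟨fun h => hf ?_, fun q hq hpq => ?_⟩
  · simpa using I.comp_mem_right f h
  · have hgf' := I.notMem_of_sub_mem (hpq hgf) hq
    rw [I.comp_mem_iff, not_or] at hgf'
    obtain ⟨hgy, hfq⟩ := hgf'
    have hqa : 𝟙 (X a) ∉ I.ideal q a a := fun h => hfq (by simpa using I.comp_mem_left h f)
    obtain ⟨hle, hpq'⟩ := hp.2 q hqa fun x hx => by
      have h1 := hpq (I.comp_mem_right (g ≫ y) (I.comp_mem_left hx f))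
      exact ((I.comp_mem_iff _ _).1 (((I.comp_mem_iff _ _).1 h1).resolve_left hgy)).resolve_right
        hfq
    refine ⟨fun x hx => ?_, hpq'⟩
    have h1 := hle (I.comp_mem_right f (I.comp_mem_left hx g))
    rw [I.comp_mem_iff, I.comp_mem_iff] at h1
    tauto

/-- If `X a` and `X b` are linked by morphisms outside the `p`-th ideal, and `p` is top, then they
are isomorphic modulo this ideal, by morphisms lying in all other ideals that are top at `a` or at
`b`. -/
theorem IsTop.exists_pure_inverse [Finite ι] {p : ι} {a b : κ} (hp : I.IsTop p a)
    (hf : ∃ f : X a ⟶ X b, f ∉ I.ideal p a b) (hg : ∃ g : X b ⟶ X a, g ∉ I.ideal p b a) :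
    ∃ (f : X a ⟶ X b) (g : X b ⟶ X a),
      f ≫ g - 𝟙 (X a) ∈ I.ideal p a a ∧ g ≫ f - 𝟙 (X b) ∈ I.ideal p b b ∧
      ∀ q, I.IsTop q a ∨ I.IsTop q b → q ≠ p → f ∈ I.ideal q a b ∧ g ∈ I.ideal q b a := by
  obtain ⟨f, hf⟩ := hf
  obtain ⟨g, hg⟩ := hg
  obtain ⟨e, he, he'⟩ := hp.exists_pure
  obtain ⟨d, hd, hd'⟩ := (hp.of_notMem hf hg).exists_pure
  obtain ⟨y, h1, h2⟩ := hp.exists_inverse_of_notMem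
    (I.comp_notMem he (I.comp_notMem hf hd)) (I.comp_notMem hd (I.comp_notMem hg he))
  refine ⟨e ≫ f ≫ d, (d ≫ g ≫ e) ≫ y, h1, h2, fun q hq hqp => ?_⟩
  simp only [I.comp_mem_iff]
  rcases hq with hq | hq
  · simp [he' q hq hqp]
  · simp [hd' q hq hqp]

open Limits

/-- A single matrix entry in the radical of the category gives an endomorphism of the direct sum in
the Jacobson radical. -/
theorem comp_mem_jacobson [Finite ι] {K : Type*} {a : K → κ} (A : Bicone fun k => X (a k))
    {k k' : K} (x : X (a k) ⟶ X (a k'))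
    (hx : ∀ t, I.IsTop t (a k) → ∀ y : X (a k') ⟶ X (a k), x ≫ y ∈ I.ideal t (a k) (a k)) :
    End.of (A.π k ≫ x ≫ A.ι k') ∈ Ideal.jacobson (⊥ : Ideal (End A.pt)) := by
  rw [Ideal.mem_jacobson_iff]
  intro (y : A.pt ⟶ A.pt)
  -- `1 + ab` is invertible as soon as `1 + ba` is.
  set w : X (a k) ⟶ A.pt := x ≫ A.ι k' ≫ y with hw
  have : IsIso (𝟙 (X (a k)) + w ≫ A.π k) := by
    refine isIso_of_forall_isTop (I := I) _ fun t ht hmem => ht.1 ?_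
    refine (add_mem_cancel_right ?_).1 hmem
    rw [hw, Category.assoc]
    exact hx t ht _
  set v := inv (𝟙 (X (a k)) + w ≫ A.π k) with hv
  have hwv : w ≫ A.π k ≫ v = 𝟙 _ - v := by
    have h1 := IsIso.hom_inv_id (𝟙 (X (a k)) + w ≫ A.π k)
    rw [← hv, Preadditive.add_comp, Category.id_comp, Category.assoc] at h1
    rw [← h1]
    abel
  refine ⟨𝟙 A.pt - A.π k ≫ v ≫ w, (Submodule.mem_bot _).2 ?_⟩
  have hwv' : w ≫ A.π k ≫ v ≫ w = w - v ≫ w := by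
    have := congrArg (· ≫ w) hwv
    simpa using this
  change (A.π k ≫ x ≫ A.ι k') ≫ y ≫ (𝟙 A.pt - A.π k ≫ v ≫ w) + (𝟙 A.pt - A.π k ≫ v ≫ w)
    - 𝟙 A.pt = 0
  have h2 : (A.π k ≫ x ≫ A.ι k') ≫ y = A.π k ≫ w := by simp [hw]
  rw [← Category.assoc, h2, Preadditive.comp_sub, Category.comp_id, Category.assoc, hwv',
    Preadditive.comp_sub]
  abel

/-- An endomorphism of a finite direct sum lies in the Jacobson radical if each of its entries lies
in the radical of the category, as tested by composing back to an endomorphism of a summand. -/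
theorem mem_jacobson_of_forall_entry [Finite ι] {K : Type*} [Fintype K] {a : K → κ}
    (A : Bicone fun k => X (a k)) (hA : ∑ k, A.π k ≫ A.ι k = 𝟙 A.pt) (x : A.pt ⟶ A.pt)
    (hx : ∀ k k' t, I.IsTop t (a k) → ∀ y : X (a k') ⟶ X (a k),
      (A.ι k ≫ x ≫ A.π k') ≫ y ∈ I.ideal t (a k) (a k)) :
    End.of x ∈ Ideal.jacobson (⊥ : Ideal (End A.pt)) := by
  have hsum : x = ∑ k, ∑ k', A.π k ≫ (A.ι k ≫ x ≫ A.π k') ≫ A.ι k' := by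
    conv_lhs => rw [← Category.id_comp x, ← Category.comp_id x, ← hA]
    simp only [Preadditive.sum_comp, Preadditive.comp_sum, Category.assoc]
    exact Finset.sum_comm
  rw [hsum]
  exact sum_mem fun k _ => sum_mem fun k' _ => comp_mem_jacobson A _ (hx k k')

/-- The matrices with entries `∑ p, f p k l` and `∑ p, g p k l` have as product an invertible
endomorphism, if the `f p k l` and `g p k l` are pure at `p` and, for each top `p`, the matrix
`f p` is monomial with inverse `g p` modulo the `p`-th ideal. -/
theorem isIso_matrix_comp [Fintype ι] {K L : Type*} [Fintype K] [Fintype L] {a : K → κ}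
    {b : L → κ} (A : Bicone fun k => X (a k)) (hA : ∑ k, A.π k ≫ A.ι k = 𝟙 A.pt)
    (B : Bicone fun l => X (b l))
    (f : ι → ∀ k l, X (a k) ⟶ X (b l)) (g : ι → ∀ l k, X (b l) ⟶ X (a k))
    (hf : ∀ p q k l, I.IsTop q (a k) → q ≠ p → f p k l ∈ I.ideal q (a k) (b l))
    (hg : ∀ p q k l, I.IsTop q (a k) → q ≠ p → g p l k ∈ I.ideal q (b l) (a k))
    (hdiag : ∀ t k, I.IsTop t (a k) → ∃ l,
      f t k l ≫ g t l k - 𝟙 _ ∈ I.ideal t (a k) (a k) ∧ ∀ l' ≠ l, f t k l' = 0)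
    (hoff : ∀ t k k' l, k ≠ k' → f t k l ≫ g t l k' = 0) :
    IsIso ((∑ k, ∑ l, A.π k ≫ (∑ p, f p k l) ≫ B.ι l) ≫
      (∑ l, ∑ k, B.π l ≫ (∑ p, g p l k) ≫ A.ι k)) := by
  classical
  refine (isUnit_iff_isIso _).1 (Ideal.isUnit_of_sub_one_mem_jacobson (A := End A.pt) ?_)
  refine mem_jacobson_of_forall_entry (I := I) A hA _ fun k k' t ht y => ?_
  have h1 : A.ι k ≫ (∑ k, ∑ l, A.π k ≫ (∑ p, f p k l) ≫ B.ι l) =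
      ∑ l, (∑ p, f p k l) ≫ B.ι l := by
    rw [Preadditive.comp_sum, Finset.sum_eq_single k]
    · simp [Preadditive.comp_sum]
    · intro i _ hi
      simp [Preadditive.comp_sum, bicone_ι_π_ne_assoc A hi.symm]
    · simp
  have h2 : (∑ l, ∑ k, B.π l ≫ (∑ p, g p l k) ≫ A.ι k) ≫ A.π k' =
      ∑ l, B.π l ≫ ∑ p, g p l k' := by
    rw [Preadditive.sum_comp]
    refine Finset.sum_congr rfl fun l _ => ?_
    rw [Preadditive.sum_comp, Finset.sum_eq_single k']
    · simp
    · intro i _ hi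
      simp [bicone_ι_π_ne A hi]
    · simp
  have h3 : (∑ l, (∑ p, f p k l) ≫ B.ι l) ≫ (∑ l, B.π l ≫ ∑ p, g p l k') =
      ∑ l, (∑ p, f p k l) ≫ ∑ p, g p l k' := by
    rw [Preadditive.sum_comp]
    refine Finset.sum_congr rfl fun l _ => ?_
    rw [Preadditive.comp_sum, Finset.sum_eq_single l]
    · simp
    · intro i _ hi
      rw [Category.assoc, bicone_ι_π_ne_assoc B hi.symm]
      simp
    · simp
  -- Modulo the `t`-th ideal only the summands with `p = q = t` survive.
  have h4 : ∀ l, ((∑ p, f p k l) ≫ (∑ q, g q l k') - f t k l ≫ g t l k') ≫ y ∈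
      I.ideal t (a k) (a k) := by
    intro l
    have e1 : (∑ p, f p k l) - f t k l ∈ I.ideal t (a k) (b l) := by
      rw [← Finset.add_sum_erase _ _ (Finset.mem_univ t), add_sub_cancel_left]
      exact sum_mem fun p hp => hf p t k l ht (Finset.ne_of_mem_erase hp).symm
    have e2 : (f t k l ≫ ((∑ q, g q l k') - g t l k')) ≫ y ∈ I.ideal t (a k) (a k) := by
      rw [← Finset.add_sum_erase _ _ (Finset.mem_univ t), add_sub_cancel_left,
        Preadditive.comp_sum, Preadditive.sum_comp]
      refine sum_mem fun q hq => ?_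
      by_contra hmem
      rw [I.comp_mem_iff, not_or] at hmem
      have htk' : I.IsTop t (a k') := ht.of_notMem hmem.1 hmem.2
      exact hmem.1 (I.comp_mem_right _ (hg q t k' l htk' (Finset.ne_of_mem_erase hq).symm))
    have e3 : ((∑ p, f p k l) ≫ (∑ q, g q l k') - f t k l ≫ g t l k') ≫ y =
        ((∑ p, f p k l) - f t k l) ≫ (∑ q, g q l k') ≫ y +
          (f t k l ≫ ((∑ q, g q l k') - g t l k')) ≫ y := by
      simp only [Preadditive.sub_comp, Preadditive.comp_sub, Category.assoc]
      abel
    rw [e3]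
    exact add_mem (I.comp_mem_left e1 _) e2
  have h5 : (∑ l, f t k l ≫ g t l k' - A.ι k ≫ A.π k') ≫ y ∈ I.ideal t (a k) (a k) := by
    by_cases hkk : k = k'
    · subst hkk
      obtain ⟨l, hl, hl'⟩ := hdiag t k ht
      rw [Finset.sum_eq_single l (fun l' _ hne => by rw [hl' l' hne, zero_comp]) (by simp),
        bicone_ι_π_self]
      exact I.comp_mem_left hl y
    · rw [Finset.sum_eq_zero fun l _ => hoff t k k' l hkk, bicone_ι_π_ne A hkk]
      simp
  have h6 : (A.ι k ≫ ((∑ k, ∑ l, A.π k ≫ (∑ p, f p k l) ≫ B.ι l) ≫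
      (∑ l, ∑ k, B.π l ≫ (∑ p, g p l k) ≫ A.ι k) - 𝟙 A.pt) ≫ A.π k') ≫ y =
      ∑ l, ((∑ p, f p k l) ≫ (∑ q, g q l k') - f t k l ≫ g t l k') ≫ y +
        (∑ l, f t k l ≫ g t l k' - A.ι k ≫ A.π k') ≫ y := by
    rw [← Preadditive.sum_comp, Finset.sum_sub_distrib, ← h3, ← h1, ← h2]
    simp only [Preadditive.sub_comp, Preadditive.comp_sub, Category.assoc, Category.id_comp]
    abel
  exact h6 ▸ add_mem (sum_mem fun l _ => h4 l) h5

end IsTop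

open Limits

/-- Two finite direct sums of objects of a completely prime family are isomorphic if for each ideal
of the family there is a bijection between the summands not killed by the ideal that preserves
classes with respect to this ideal. -/
theorem nonempty_iso_of_equiv [Finite ι] {K L : Type*} [Fintype K] [Fintype L] {a : K → κ}
    {b : L → κ} (A : Bicone fun k => X (a k)) (hA : ∑ k, A.π k ≫ A.ι k = 𝟙 A.pt)
    (B : Bicone fun l => X (b l)) (hB : ∑ l, B.π l ≫ B.ι l = 𝟙 B.pt)
    (φ : ∀ p, {k // 𝟙 (X (a k)) ∉ I.ideal p (a k) (a k)} ≃
      {l // 𝟙 (X (b l)) ∉ I.ideal p (b l) (b l)})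
    (hφ : ∀ p k, ∃ (f : X (a k.1) ⟶ X (b (φ p k).1)) (g : X (b (φ p k).1) ⟶ X (a k.1)),
      f ∉ I.ideal p _ _ ∧ g ∉ I.ideal p _ _) :
    Nonempty (A.pt ≅ B.pt) := by
  classical
  have := Fintype.ofFinite ι
  let _ : LinearOrder ι := linearOrderOfSTO WellOrderingRel
  -- Only the top ideals enter the construction, each maximal ideal being taken once.
  let rel (p : ι) (k : K) (l : L) : Prop :=
    I.IsTop p (a k) ∧ ∃ h, (φ p ⟨k, h⟩).1 = l
  have hex : ∀ p k l, ∃ (f : X (a k) ⟶ X (b l)) (g : X (b l) ⟶ X (a k)),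
      (rel p k l → f ≫ g - 𝟙 _ ∈ I.ideal p _ _ ∧ g ≫ f - 𝟙 _ ∈ I.ideal p _ _) ∧
      (¬ rel p k l → f = 0 ∧ g = 0) ∧
      ∀ q, I.IsTop q (a k) ∨ I.IsTop q (b l) → q ≠ p →
        f ∈ I.ideal q _ _ ∧ g ∈ I.ideal q _ _ := by
    intro p k l
    by_cases h : rel p k l
    · obtain ⟨ht, h', rfl⟩ := h
      obtain ⟨f, g, hf, hg⟩ := hφ p ⟨k, h'⟩
      obtain ⟨f, g, h1, h2, h3⟩ := ht.exists_pure_inverse ⟨f, hf⟩ ⟨g, hg⟩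
      exact ⟨f, g, fun _ => ⟨h1, h2⟩, fun hn => absurd ⟨ht, h', rfl⟩ hn, h3⟩
    · exact ⟨0, 0, fun h' => absurd h' h, fun _ => ⟨rfl, rfl⟩,
        fun _ _ _ => ⟨zero_mem _, zero_mem _⟩⟩
  choose f g hinv hzero hpure using hex
  have huniqL : ∀ p k l l', rel p k l → rel p k l' → l = l' := by
    rintro p k l l' ⟨_, _, rfl⟩ ⟨_, _, rfl⟩
    rfl
  have huniqK : ∀ p k k' l, rel p k l → rel p k' l → k = k' := by
    rintro p k k' l ⟨_, h, rfl⟩ ⟨_, h', he⟩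
    exact congrArg Subtype.val ((φ p).injective (Subtype.ext he)).symm
  have u1 := isIso_matrix_comp (I := I) A hA B f (fun p l k => g p k l)
    (fun p q k l hq hqp => (hpure p k l q (Or.inl hq) hqp).1)
    (fun p q k l hq hqp => (hpure p k l q (Or.inl hq) hqp).2)
    (fun t k ht => by
      have hr : rel t k (φ t ⟨k, ht.1⟩).1 := ⟨ht, ht.1, rfl⟩
      exact ⟨_, (hinv t k _ hr).1, fun l' hl' =>
        (hzero t k l' fun h => hl' (huniqL t k _ _ h hr)).1⟩)
    (fun t k k' l hkk => by
      by_cases h : rel t k l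
      · rw [(hzero t k' l fun h' => hkk (huniqK t k k' l h h')).2, comp_zero]
      · rw [(hzero t k l h).1, zero_comp])
  have u2 := isIso_matrix_comp (I := I) B hB A (fun p l k => g p k l) f
    (fun p q l k hq hqp => (hpure p k l q (Or.inr hq) hqp).2)
    (fun p q l k hq hqp => (hpure p k l q (Or.inr hq) hqp).1)
    (fun t l ht => by
      obtain ⟨k, hk⟩ := (φ t).surjective ⟨l, ht.1⟩
      have hl : (φ t k).1 = l := congrArg Subtype.val hk
      subst hl
      obtain ⟨f', g', hf', hg'⟩ := hφ t k
      have hr : rel t k.1 (φ t k).1 := ⟨ht.of_notMem hg' hf', k.2, rfl⟩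
      exact ⟨_, (hinv t _ _ hr).2, fun k' hk' =>
        (hzero t k' _ fun h => hk' (huniqK t _ _ _ h hr)).2⟩)
    (fun t l l' k hll => by
      by_cases h : rel t k l
      · rw [(hzero t k l' fun h' => hll (huniqL t k _ _ h h')).1, comp_zero]
      · rw [(hzero t k l h).2, zero_comp])
  set h := ∑ k, ∑ l, A.π k ≫ (∑ p, f p k l) ≫ B.ι l
  set h' := ∑ l, ∑ k, B.π l ≫ (∑ p, g p k l) ≫ A.ι k
  have : IsSplitMono h := IsSplitMono.mk' ⟨h' ≫ inv (h ≫ h'), by simp [← Category.assoc]⟩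
  have : Epi h := epi_of_epi h' h
  have : IsIso h := isIso_of_epi_of_isSplitMono h
  exact ⟨asIso h⟩

end CompletelyPrimeFamily

end PrimeFamily

/-! ### Uniserial modules and direct decompositions -/

section Uniserial

variable {S : Type*} [Ring S] {U V W : Type*} [AddCommGroup U] [Module S U] [AddCommGroup V]
  [Module S V] [AddCommGroup W] [Module S W]

namespace IsUniserial

theorem injective_of_comp (hV : IsUniserial S V) [Nontrivial U] {f : U →ₗ[S] V} {g : V →ₗ[S] W}
    (h : Function.Injective (g ∘ₗ f)) : Function.Injective g := by
  have hf : Function.Injective f := Function.Injective.of_comp (f := g) h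
  rw [← LinearMap.ker_eq_bot, LinearMap.ker_comp] at h
  rw [← LinearMap.ker_eq_bot]
  rcases hV (LinearMap.ker g) (LinearMap.range f) with hle | hle
  · rw [← Submodule.map_comap_eq_of_le hle, h, Submodule.map_bot]
  · obtain ⟨x, hx⟩ := exists_ne (0 : U)
    have : x ∈ (LinearMap.ker g).comap f := hle ⟨x, rfl⟩
    rw [h] at this
    exact absurd ((Submodule.mem_bot S).1 this) hx

theorem surjective_of_comp (hV : IsUniserial S V) [Nontrivial W] {f : U →ₗ[S] V}
    {g : V →ₗ[S] W} (h : Function.Surjective (g ∘ₗ f)) : Function.Surjective f := by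
  rcases hV (LinearMap.ker g) (LinearMap.range f) with hle | hle
  · intro y
    obtain ⟨x, hx⟩ := h (g y)
    obtain ⟨z, hz⟩ := hle (show y - f x ∈ LinearMap.ker g by simp [← hx])
    exact ⟨z + x, by simp [hz]⟩
  · obtain ⟨w, hw⟩ := exists_ne (0 : W)
    obtain ⟨x, rfl⟩ := h w
    exact absurd (hle ⟨x, rfl⟩) hw

theorem injective_or_injective_of_add (hU : IsUniserial S U) {f g : U →ₗ[S] V}
    (h : Function.Injective (f + g)) : Function.Injective f ∨ Function.Injective g := by
  simp only [← LinearMap.ker_eq_bot] at h ⊢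
  rcases hU (LinearMap.ker f) (LinearMap.ker g) with hle | hle
  · left
    rw [← le_bot_iff, ← h]
    intro x hx
    simp [LinearMap.mem_ker.1 hx, LinearMap.mem_ker.1 (hle hx)]
  · right
    rw [← le_bot_iff, ← h]
    intro x hx
    simp [LinearMap.mem_ker.1 hx, LinearMap.mem_ker.1 (hle hx)]

theorem surjective_or_surjective_of_add (hV : IsUniserial S V) {f g : U →ₗ[S] V}
    (h : Function.Surjective (f + g)) : Function.Surjective f ∨ Function.Surjective g := by
  simp only [← LinearMap.range_eq_top] at h ⊢
  rcases hV (LinearMap.range f) (LinearMap.range g) with hle | hle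
  · right
    rw [← top_le_iff, ← h]
    rintro _ ⟨x, rfl⟩
    exact add_mem (hle ⟨x, rfl⟩) ⟨x, rfl⟩
  · left
    rw [← top_le_iff, ← h]
    rintro _ ⟨x, rfl⟩
    exact add_mem ⟨x, rfl⟩ (hle ⟨x, rfl⟩)

theorem le_or_le_of_le_range (hU : IsUniserial S U) (f : U →ₗ[S] V) {A B : Submodule S V}
    (hA : A ≤ LinearMap.range f) (hB : B ≤ LinearMap.range f) : A ≤ B ∨ B ≤ A := by
  rw [← Submodule.map_comap_eq_of_le hA, ← Submodule.map_comap_eq_of_le hB]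
  exact (hU (A.comap f) (B.comap f)).imp (Submodule.map_mono ·) (Submodule.map_mono ·)

theorem le_or_le_of_ker_le (hV : IsUniserial S V) (f : U →ₗ[S] V) {A B : Submodule S U}
    (hA : LinearMap.ker f ≤ A) (hB : LinearMap.ker f ≤ B) : A ≤ B ∨ B ≤ A := by
  rw [← Submodule.comap_map_eq_self hA, ← Submodule.comap_map_eq_self hB]
  exact (hV (A.map f) (B.map f)).imp (Submodule.comap_mono ·) (Submodule.comap_mono ·)

end IsUniserial

/-- The maps `inj k` and `proj k` are the injections and projections of a decomposition of `E` as
the direct sum of finitely many modules `U k`. -/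
structure IsDirectDecomposition {κ : Type*} [Fintype κ] {E : Type*} [AddCommGroup E] [Module S E]
    {U : κ → Type*} [∀ k, AddCommGroup (U k)] [∀ k, Module S (U k)]
    (inj : ∀ k, U k →ₗ[S] E) (proj : ∀ k, E →ₗ[S] U k) : Prop where
  proj_comp_inj k : proj k ∘ₗ inj k = LinearMap.id
  proj_comp_inj_of_ne {k k'} : k ≠ k' → proj k' ∘ₗ inj k = 0
  sum_inj_comp_proj : ∑ k, inj k ∘ₗ proj k = LinearMap.id

namespace IsDirectDecomposition

variable {κ l : Type*} [Fintype κ] [Fintype l] {E : Type*} [AddCommGroup E] [Module S E]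
  {U : κ → Type*} [∀ k, AddCommGroup (U k)] [∀ k, Module S (U k)]
  {inj : ∀ k, U k →ₗ[S] E} {proj : ∀ k, E →ₗ[S] U k}
  {V : l → Type*} [∀ j, AddCommGroup (V j)] [∀ j, Module S (V j)]
  {inj' : ∀ j, V j →ₗ[S] E} {proj' : ∀ j, E →ₗ[S] V j}

theorem proj_inj (h : IsDirectDecomposition inj proj) (k : κ) (u : U k) : proj k (inj k u) = u :=
  LinearMap.congr_fun (h.proj_comp_inj k) u

theorem sum_inj_proj (h : IsDirectDecomposition inj proj) (x : E) :
    ∑ k, inj k (proj k x) = x := by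
  simpa using LinearMap.congr_fun h.sum_inj_comp_proj x

theorem range_le_ker (h : IsDirectDecomposition inj proj) {k k' : κ} (hk : k ≠ k') :
    LinearMap.range (inj k) ≤ LinearMap.ker (proj k') :=
  LinearMap.range_le_ker_iff.2 (h.proj_comp_inj_of_ne hk)

theorem isCompl (h : IsDirectDecomposition inj proj) (k : κ) :
    IsCompl (LinearMap.range (inj k)) (LinearMap.ker (proj k)) := by
  constructor
  · rw [Submodule.disjoint_def]
    rintro _ ⟨u, rfl⟩ hu
    rw [LinearMap.mem_ker, h.proj_inj] at hu
    rw [hu, map_zero]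
  · rw [codisjoint_iff, Submodule.eq_top_iff']
    intro x
    exact Submodule.mem_sup.2 ⟨inj k (proj k x), ⟨_, rfl⟩, x - inj k (proj k x),
      by simp [h.proj_inj], by abel⟩

theorem supIndep_range (h : IsDirectDecomposition inj proj) :
    Finset.univ.SupIndep fun k => LinearMap.range (inj k) := by
  intro t _ k _ hk
  refine (h.isCompl k).disjoint.mono_right (Finset.sup_le fun k' hk' => h.range_le_ker ?_)
  rintro rfl
  exact hk hk'

theorem supIndep_toDual_ker (h : IsDirectDecomposition inj proj) :
    Finset.univ.SupIndep fun k => OrderDual.toDual (LinearMap.ker (proj k)) := by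
  intro t _ k _ hk
  refine Disjoint.mono_right (Finset.sup_le fun k' hk' => ?_)
    (h.isCompl k).symm.codisjoint.dual
  refine OrderDual.toDual_le_toDual.2 (h.range_le_ker ?_)
  rintro rfl
  exact hk hk'

theorem sup_range (h : IsDirectDecomposition inj proj) :
    Finset.univ.sup (fun k => LinearMap.range (inj k)) = ⊤ := by
  rw [Submodule.eq_top_iff']
  intro x
  rw [← h.sum_inj_proj x]
  exact sum_mem fun k hk => Finset.le_sup (f := fun k => LinearMap.range (inj k)) hk ⟨_, rfl⟩

theorem inf_ker (h : IsDirectDecomposition inj proj) :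
    Finset.univ.inf (fun k => LinearMap.ker (proj k)) = ⊥ := by
  rw [← le_bot_iff]
  intro x hx
  rw [Submodule.mem_bot, ← h.sum_inj_proj x]
  refine Finset.sum_eq_zero fun k hk => ?_
  rw [LinearMap.mem_ker.1 (Finset.inf_le (f := fun k => LinearMap.ker (proj k)) hk hx), map_zero]

theorem range_ne_bot (h : IsDirectDecomposition inj proj) (k : κ) [Nontrivial (U k)] :
    LinearMap.range (inj k) ≠ ⊥ := by
  intro h0
  obtain ⟨u, hu⟩ := exists_ne (0 : U k)
  refine hu ?_
  rw [← h.proj_inj k u, LinearMap.range_eq_bot.1 h0, LinearMap.zero_apply, map_zero]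

theorem ker_ne_top (h : IsDirectDecomposition inj proj) (k : κ) [Nontrivial (U k)] :
    LinearMap.ker (proj k) ≠ ⊤ := by
  intro h0
  obtain ⟨u, hu⟩ := exists_ne (0 : U k)
  refine hu ?_
  rw [← h.proj_inj k u, LinearMap.ker_eq_top.1 h0, LinearMap.zero_apply]

/-- Two decompositions of a module into uniserial summands: the nonzero summands of the first are
matched injectively with those of the second, so that the corresponding entries of the identity
matrix of `E` are injective. -/
theorem exists_injective_comp (h : IsDirectDecomposition inj proj)
    (h' : IsDirectDecomposition inj' proj') (hU : ∀ k, IsUniserial S (U k))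
    (hV : ∀ j, IsUniserial S (V j)) :
    ∃ σ : {k // Nontrivial (U k)} → {j // Nontrivial (V j)}, Function.Injective σ ∧
      ∀ k, Function.Injective (proj' (σ k).1 ∘ₗ inj k.1) := by
  obtain ⟨σ, hσ, hd⟩ := exists_injective_inf_eq_bot (fun k => LinearMap.range (inj k))
    (fun j => LinearMap.ker (proj' j)) h.supIndep_range
    (fun k _ _ => (hU k).le_or_le_of_le_range (inj k)) h'.inf_ker
    (fun j _ _ => (hV j).le_or_le_of_ker_le (proj' j))
  let c : {k // Nontrivial (U k)} → {k // LinearMap.range (inj k) ≠ ⊥} :=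
    fun k => ⟨k.1, have := k.2; h.range_ne_bot k.1⟩
  have hinj : ∀ k, Function.Injective (proj' (σ (c k)) ∘ₗ inj k.1) := by
    intro k
    rw [injective_iff_map_eq_zero]
    intro u hu
    have : inj k.1 u ∈ LinearMap.range (inj k.1) ⊓ LinearMap.ker (proj' (σ (c k))) :=
      ⟨⟨u, rfl⟩, hu⟩
    rw [hd (c k), Submodule.mem_bot] at this
    rw [← h.proj_inj k.1 u, this, map_zero]
  refine ⟨fun k => ⟨σ (c k), have := k.2; (hinj k).nontrivial⟩, fun k k' hk => ?_, hinj⟩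
  have hc : c k = c k' := hσ (congrArg Subtype.val hk)
  have hc' := congrArg Subtype.val hc
  exact Subtype.ext hc'

/-- The kernels of the projections are coindependent with uniserial quotients, so that this is
`exists_injective_inf_eq_bot` in the dual of the lattice of submodules. -/
theorem exists_surjective_comp (h : IsDirectDecomposition inj proj)
    (h' : IsDirectDecomposition inj' proj') (hU : ∀ k, IsUniserial S (U k))
    (hV : ∀ j, IsUniserial S (V j)) :
    ∃ σ : {j // Nontrivial (V j)} → {k // Nontrivial (U k)}, Function.Injective σ ∧
      ∀ j, Function.Surjective (proj' j.1 ∘ₗ inj (σ j).1) := by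
  obtain ⟨σ, hσ, hd⟩ := exists_injective_inf_eq_bot
    (fun j => OrderDual.toDual (LinearMap.ker (proj' j)))
    (fun k => OrderDual.toDual (LinearMap.range (inj k))) h'.supIndep_toDual_ker
    (fun j A B hA hB => ((hV j).le_or_le_of_ker_le (proj' j) (A := OrderDual.ofDual A)
      (B := OrderDual.ofDual B) hA hB).symm) h.sup_range
    (fun k A B hA hB => ((hU k).le_or_le_of_le_range (inj k) (A := OrderDual.ofDual A)
      (B := OrderDual.ofDual B) hA hB).symm)
  let c : {j // Nontrivial (V j)} → {j // OrderDual.toDual (LinearMap.ker (proj' j)) ≠ ⊥} :=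
    fun j => ⟨j.1, have := j.2; fun h0 => h'.ker_ne_top j.1 h0⟩
  have hsurj : ∀ j, Function.Surjective (proj' j.1 ∘ₗ inj (σ (c j))) := by
    intro j v
    have htop : LinearMap.ker (proj' j.1) ⊔ LinearMap.range (inj (σ (c j))) = ⊤ := hd (c j)
    obtain ⟨x, hx, _, ⟨u, rfl⟩, hxu⟩ := Submodule.mem_sup.1
      (htop ▸ Submodule.mem_top : inj' j.1 v ∈ _)
    refine ⟨u, ?_⟩
    have := congrArg (proj' j.1) hxu
    rwa [map_add, LinearMap.mem_ker.1 hx, zero_add, h'.proj_inj] at this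
  refine ⟨fun j => ⟨σ (c j), have := j.2; (hsurj j).nontrivial⟩, fun j j' hj => ?_, hsurj⟩
  have hc : c j = c j' := hσ (congrArg Subtype.val hj)
  have hc' := congrArg Subtype.val hc
  exact Subtype.ext hc'

end IsDirectDecomposition

end Uniserial

/-! ### The additive category of modules with chains -/

namespace ChainModule

variable {S : Type u} [Ring S] {n : ℕ}

theorem hom_ext {M N : ChainModule.{v} S n} {f g : M ⟶ N}
    (h : ∀ x, Hom.toLinearMap f x = Hom.toLinearMap g x) : f = g :=
  Hom.ext (LinearMap.ext h)

section

variable (M N : ChainModule.{v} S n)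

instance : Zero (M ⟶ N) := ⟨⟨0, fun j _ _ => (N.chain j).zero_mem⟩⟩

instance : Add (M ⟶ N) :=
  ⟨fun f g => ⟨Hom.toLinearMap f + Hom.toLinearMap g, fun j x hx =>
    (N.chain j).add_mem (Hom.map_mem f j x hx) (Hom.map_mem g j x hx)⟩⟩

instance : Neg (M ⟶ N) :=
  ⟨fun f => ⟨-Hom.toLinearMap f, fun j x hx => (N.chain j).neg_mem (Hom.map_mem f j x hx)⟩⟩

instance : AddCommGroup (M ⟶ N) :=
  { AddGroup.ofLeftAxioms (G := M ⟶ N) (fun _ _ _ => hom_ext fun _ => add_assoc _ _ _)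
      (fun _ => hom_ext fun _ => zero_add _) (fun _ => hom_ext fun _ => neg_add_cancel _) with
    add_comm := fun _ _ => hom_ext fun _ => add_comm _ _ }

end

instance : Preadditive (ChainModule.{v} S n) where
  add_comp _ _ _ _ _ g := hom_ext fun _ => map_add (Hom.toLinearMap g) _ _
  comp_add _ _ _ _ _ _ := hom_ext fun _ => rfl

section factorMap

variable {L M N : ChainModule.{v} S n} (i : Fin n)

theorem factorMap_id : factorMap (𝟙 M) i = LinearMap.id :=
  LinearMap.ext fun x => Submodule.Quotient.induction_on _ x fun _ => rfl

theorem factorMap_comp (f : L ⟶ M) (g : M ⟶ N) :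
    factorMap (f ≫ g) i = factorMap g i ∘ₗ factorMap f i :=
  LinearMap.ext fun x => Submodule.Quotient.induction_on _ x fun _ => rfl

theorem factorMap_add (f g : M ⟶ N) : factorMap (f + g) i = factorMap f i + factorMap g i :=
  LinearMap.ext fun x => Submodule.Quotient.induction_on _ x fun _ => rfl

/-- The additive map sending a morphism to the induced morphism of `i`-th factor modules. -/
def factorMapHom (M N : ChainModule.{v} S n) (i : Fin n) :
    (M ⟶ N) →+ (M.Factor i →ₗ[S] N.Factor i) :=
  AddMonoidHom.mk' (fun f => factorMap f i) (factorMap_add i)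

theorem factorMap_zero : factorMap (0 : M ⟶ N) i = 0 :=
  (factorMapHom M N i).map_zero

theorem factorMap_neg (f : M ⟶ N) : factorMap (-f) i = -factorMap f i :=
  (factorMapHom M N i).map_neg f

theorem factorMap_sum {κ : Type*} (s : Finset κ) (f : κ → (M ⟶ N)) :
    factorMap (∑ k ∈ s, f k) i = ∑ k ∈ s, factorMap (f k) i :=
  map_sum (factorMapHom M N i) f s

end factorMap

/-- A five lemma argument along the chains. -/
theorem isIso_of_bijective_factorMap {M N : ChainModule.{v} S n} (f : M ⟶ N)
    (hf : ∀ i, Function.Bijective (factorMap f i)) : IsIso f := by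
  have key : ∀ j : Fin (n + 1), (∀ x ∈ M.chain j, Hom.toLinearMap f x = 0 → x = 0) ∧
      ∀ y ∈ N.chain j, ∃ x ∈ M.chain j, Hom.toLinearMap f x = y := by
    intro j
    induction j using Fin.induction with
    | zero =>
      rw [chain_zero, chain_zero]
      refine ⟨fun x hx _ => (Submodule.mem_bot S).1 hx, fun y hy => ⟨0, zero_mem _, ?_⟩⟩
      rw [(Submodule.mem_bot S).1 hy, map_zero]
    | succ i ih =>
      obtain ⟨hinj, hsurj⟩ := ih
      refine ⟨fun x hx h0 => hinj x ?_ h0, fun y hy => ?_⟩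
      · have h1 : factorMap f i (Submodule.Quotient.mk ⟨x, hx⟩) = 0 :=
          (Submodule.Quotient.mk_eq_zero _).2 (by
            change Hom.toLinearMap f x ∈ N.chain i.castSucc
            rw [h0]
            exact zero_mem _)
        have h2 := (hf i).1 (h1.trans (map_zero (factorMap f i)).symm)
        exact (Submodule.Quotient.mk_eq_zero
          ((M.chain i.castSucc).submoduleOf (M.chain i.succ))).1 h2
      · obtain ⟨q, hq⟩ := (hf i).2 (Submodule.Quotient.mk ⟨y, hy⟩)
        obtain ⟨⟨x, hx⟩, rfl⟩ := Submodule.Quotient.mk_surjective _ q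
        have h1 : Hom.toLinearMap f x - y ∈ N.chain i.castSucc :=
          (Submodule.Quotient.eq
            ((N.chain i.castSucc).submoduleOf (N.chain i.succ))).1 hq
        obtain ⟨z, hz, hzy⟩ := hsurj _ h1
        refine ⟨x - z, sub_mem hx (M.chain_mono i.castSucc_lt_succ.le hz), ?_⟩
        rw [map_sub, hzy, sub_sub_cancel]
  have hinj : Function.Injective (Hom.toLinearMap f) := by
    rw [injective_iff_map_eq_zero]
    exact fun x => (key (Fin.last n)).1 x (by rw [chain_last]; trivial)
  have hsurj : Function.Surjective (Hom.toLinearMap f) := fun y => by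
    obtain ⟨x, -, hx⟩ := (key (Fin.last n)).2 y (by rw [chain_last]; trivial)
    exact ⟨x, hx⟩
  let e := LinearEquiv.ofBijective (Hom.toLinearMap f) ⟨hinj, hsurj⟩
  refine ⟨⟨e.symm.toLinearMap, fun j y hy => ?_⟩, hom_ext e.symm_apply_apply,
    hom_ext e.apply_symm_apply⟩
  obtain ⟨x, hx, rfl⟩ := (key j).2 y hy
  exact (e.symm_apply_apply x).symm ▸ hx

/-! ### Classes of the summands of isomorphic direct sums -/

section Bicone

open Limits

/-- `directSum M` with its injections and projections. -/
def directSumBicone {r : ℕ} (M : Fin r → ChainModule.{v} S n) : Bicone M where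
  pt := directSum M
  π k := ⟨LinearMap.proj k, fun _ _ hx => hx k (Set.mem_univ k)⟩
  ι k := ⟨LinearMap.single S (fun k => (M k).carrier) k, fun j x hx k' _ => by
    rcases eq_or_ne k' k with rfl | h
    · change Pi.single (M := fun k => (M k).carrier) k' x k' ∈ (M k').chain j
      rwa [Pi.single_eq_same]
    · change Pi.single (M := fun k => (M k).carrier) k x k' ∈ (M k').chain j
      rw [Pi.single_eq_of_ne h]
      exact zero_mem _⟩
  ι_π k k' := by
    rcases eq_or_ne k k' with rfl | h
    · simpa using hom_ext fun x => Pi.single_eq_same (M := fun k => (M k).carrier) k x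
    · simpa [h] using hom_ext fun x =>
        Pi.single_eq_of_ne (M := fun k => (M k).carrier) h.symm x

/-- Evaluation of morphisms at a fixed element, as an additive map. -/
def evalHom {M : ChainModule.{v} S n} (N : ChainModule.{v} S n) (x : M.carrier) :
    (M ⟶ N) →+ N.carrier :=
  AddMonoidHom.mk' (fun f => Hom.toLinearMap f x) fun _ _ => rfl

theorem sum_directSumBicone {r : ℕ} (M : Fin r → ChainModule.{v} S n) :
    ∑ k, (directSumBicone M).π k ≫ (directSumBicone M).ι k = 𝟙 (directSumBicone M).pt := by
  refine hom_ext fun x => (map_sum (evalHom (directSumBicone M).pt x) _ _).trans ?_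
  exact Finset.univ_sum_single (M := fun k => (M k).carrier) x

variable {r s : ℕ} {M : Fin r → ChainModule.{v} S n} {N : Fin s → ChainModule.{v} S n}

theorem isDirectDecomposition_factorMap (A : Bicone M) (hA : ∑ k, A.π k ≫ A.ι k = 𝟙 A.pt)
    (i : Fin n) :
    IsDirectDecomposition (fun k => factorMap (A.ι k) i) (fun k => factorMap (A.π k) i) where
  proj_comp_inj k := by rw [← factorMap_comp, bicone_ι_π_self, factorMap_id]
  proj_comp_inj_of_ne h := by rw [← factorMap_comp, bicone_ι_π_ne A h, factorMap_zero]
  sum_inj_comp_proj := by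
    simp_rw [← factorMap_comp]
    rw [← factorMap_sum, hA, factorMap_id]

theorem isDirectDecomposition_factorMap_of_iso {E : ChainModule.{v} S n} (A : Bicone M)
    (hA : ∑ k, A.π k ≫ A.ι k = 𝟙 A.pt) (e : E ≅ A.pt) (i : Fin n) :
    IsDirectDecomposition (fun k => factorMap (A.ι k ≫ e.inv) i)
      (fun k => factorMap (e.hom ≫ A.π k) i) where
  proj_comp_inj k := by rw [← factorMap_comp]; simp [factorMap_id]
  proj_comp_inj_of_ne h := by
    rw [← factorMap_comp]
    simp [bicone_ι_π_ne A h, factorMap_zero]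
  sum_inj_comp_proj := by
    simp_rw [← factorMap_comp]
    rw [← factorMap_sum, ← factorMap_id, ← e.hom_inv_id]
    congr 1
    have := congrArg (fun x => e.hom ≫ x ≫ e.inv) hA
    simpa [Preadditive.sum_comp, Preadditive.comp_sum] using this

variable (hM : ∀ k i, IsUniserial S ((M k).Factor i)) (hN : ∀ l i, IsUniserial S ((N l).Factor i))
include hM hN

theorem exists_equiv_sameMonogenyClass (A : Bicone M)
    (hA : ∑ k, A.π k ≫ A.ι k = 𝟙 A.pt) (B : Bicone N) (hB : ∑ l, B.π l ≫ B.ι l = 𝟙 B.pt)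
    (e : A.pt ≅ B.pt) (i : Fin n) :
    ∃ φ : nonzeroFactorIndices M i ≃ nonzeroFactorIndices N i,
      ∀ k, SameMonogenyClass i (M k.1) (N (φ k).1) := by
  have h := isDirectDecomposition_factorMap A hA i
  have h' := isDirectDecomposition_factorMap_of_iso B hB e i
  obtain ⟨σ, hσ, hσ'⟩ := h.exists_injective_comp h' (hM · i) (hN · i)
  obtain ⟨τ, hτ, hτ'⟩ := h'.exists_injective_comp h (hN · i) (hM · i)
  simp only [← factorMap_comp] at hσ' hτ'
  obtain ⟨φ, hφ⟩ := exists_equiv_of_injective_of_le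
    (fun A B : ChainModule.{v} S n => ∃ f : A ⟶ B, Function.Injective (factorMap f i))
    (fun {A B C} ⟨f, hf⟩ ⟨g, hg⟩ => ⟨f ≫ g, by rw [factorMap_comp]; exact hg.comp hf⟩)
    (fun k : nonzeroFactorIndices M i => M k.1) (fun l : nonzeroFactorIndices N i => N l.1)
    hσ (fun k => ⟨_, hσ' k⟩) hτ (fun l => ⟨_, hτ' l⟩)
  refine ⟨φ, fun k => ?_⟩
  obtain ⟨⟨f, hf⟩, g, hg⟩ := hφ k
  exact ⟨f, g, hf, hg⟩

theorem exists_equiv_sameEpigenyClass (A : Bicone M)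
    (hA : ∑ k, A.π k ≫ A.ι k = 𝟙 A.pt) (B : Bicone N) (hB : ∑ l, B.π l ≫ B.ι l = 𝟙 B.pt)
    (e : A.pt ≅ B.pt) (i : Fin n) :
    ∃ φ : nonzeroFactorIndices M i ≃ nonzeroFactorIndices N i,
      ∀ k, SameEpigenyClass i (M k.1) (N (φ k).1) := by
  have h := isDirectDecomposition_factorMap A hA i
  have h' := isDirectDecomposition_factorMap_of_iso B hB e i
  obtain ⟨τ, hτ, hτ'⟩ := h.exists_surjective_comp h' (hM · i) (hN · i)
  obtain ⟨σ, hσ, hσ'⟩ := h'.exists_surjective_comp h (hN · i) (hM · i)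
  simp only [← factorMap_comp] at hσ' hτ'
  obtain ⟨φ, hφ⟩ := exists_equiv_of_injective_of_le
    (fun A B : ChainModule.{v} S n => ∃ f : B ⟶ A, Function.Surjective (factorMap f i))
    (fun {A B C} ⟨f, hf⟩ ⟨g, hg⟩ => ⟨g ≫ f, by rw [factorMap_comp]; exact hf.comp hg⟩)
    (fun k : nonzeroFactorIndices M i => M k.1) (fun l : nonzeroFactorIndices N i => N l.1)
    hσ (fun k => ⟨_, hσ' k⟩) hτ (fun l => ⟨_, hτ' l⟩)
  refine ⟨φ, fun k => ?_⟩
  obtain ⟨⟨f, hf⟩, g, hg⟩ := hφ k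
  exact ⟨g, f, hg, hf⟩

end Bicone

/-! ### Monogeny and epigeny ideals -/

section ideals

/-- The objects all of whose factor modules are uniserial. -/
abbrev UniserialFactors (S : Type u) [Ring S] (n : ℕ) :=
  {M : ChainModule.{v} S n // ∀ i, IsUniserial S (M.Factor i)}

variable {L M N : ChainModule.{v} S n} {i : Fin n}

/-- The morphisms that are not injective on the `i`-th factor modules, together with all morphisms
from an object whose `i`-th factor module is zero. -/
def monoIdeal (i : Fin n) (hM : IsUniserial S (M.Factor i)) (N : ChainModule.{v} S n) :
    AddSubgroup (M ⟶ N) where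
  carrier := {f | Nontrivial (M.Factor i) → ¬ Function.Injective (factorMap f i)}
  zero_mem' := fun _ h => by
    rw [factorMap_zero] at h
    obtain ⟨x, hx⟩ := exists_ne (0 : M.Factor i)
    exact hx (h rfl)
  add_mem' := fun hf hg h0 h => by
    rw [factorMap_add] at h
    exact (hM.injective_or_injective_of_add h).elim (hf h0) (hg h0)
  neg_mem' := fun hf h0 h => hf h0 (by
    rw [factorMap_neg] at h
    exact fun x y hxy => h (congrArg Neg.neg hxy))

/-- The morphisms that are not surjective on the `i`-th factor modules, together with all morphisms
to an object whose `i`-th factor module is zero. -/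
def epiIdeal (i : Fin n) (M : ChainModule.{v} S n) (hN : IsUniserial S (N.Factor i)) :
    AddSubgroup (M ⟶ N) where
  carrier := {f | Nontrivial (N.Factor i) → ¬ Function.Surjective (factorMap f i)}
  zero_mem' := fun _ h => by
    rw [factorMap_zero] at h
    obtain ⟨y, hy⟩ := exists_ne (0 : N.Factor i)
    obtain ⟨x, hx⟩ := h y
    exact hy hx.symm
  add_mem' := fun hf hg h0 h => by
    rw [factorMap_add] at h
    exact (hN.surjective_or_surjective_of_add h).elim (hf h0) (hg h0)
  neg_mem' := fun hf h0 h => hf h0 (by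
    rw [factorMap_neg] at h
    intro y
    obtain ⟨x, hx⟩ := h (-y)
    exact ⟨x, neg_injective hx⟩)

theorem notMem_monoIdeal (hM : IsUniserial S (M.Factor i)) {f : M ⟶ N} :
    f ∉ monoIdeal i hM N ↔ Nontrivial (M.Factor i) ∧ Function.Injective (factorMap f i) := by
  change ¬ (_ → ¬ _) ↔ _
  tauto

theorem notMem_epiIdeal (hN : IsUniserial S (N.Factor i)) {f : M ⟶ N} :
    f ∉ epiIdeal i M hN ↔ Nontrivial (N.Factor i) ∧ Function.Surjective (factorMap f i) := by
  change ¬ (_ → ¬ _) ↔ _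
  tauto

theorem id_notMem_monoIdeal (hM : IsUniserial S (M.Factor i)) :
    𝟙 M ∉ monoIdeal i hM M ↔ Nontrivial (M.Factor i) := by
  rw [notMem_monoIdeal, factorMap_id]
  exact and_iff_left Function.injective_id

theorem id_notMem_epiIdeal (hM : IsUniserial S (M.Factor i)) :
    𝟙 M ∉ epiIdeal i M hM ↔ Nontrivial (M.Factor i) := by
  rw [notMem_epiIdeal, factorMap_id]
  exact and_iff_left Function.surjective_id

theorem comp_mem_monoIdeal_iff (hL : IsUniserial S (L.Factor i)) (hM : IsUniserial S (M.Factor i))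
    (f : L ⟶ M) (g : M ⟶ N) :
    f ≫ g ∈ monoIdeal i hL N ↔ f ∈ monoIdeal i hL M ∨ g ∈ monoIdeal i hM N := by
  rw [← not_iff_not, not_or, notMem_monoIdeal, notMem_monoIdeal, notMem_monoIdeal, factorMap_comp]
  constructor
  · rintro ⟨h0, h⟩
    have hf : Function.Injective (factorMap f i) := Function.Injective.of_comp (f := factorMap g i) h
    exact ⟨⟨h0, hf⟩, hf.nontrivial, hM.injective_of_comp h⟩
  · rintro ⟨⟨h0, hf⟩, -, hg⟩
    exact ⟨h0, hg.comp hf⟩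

theorem comp_mem_epiIdeal_iff (hM : IsUniserial S (M.Factor i)) (hN : IsUniserial S (N.Factor i))
    (f : L ⟶ M) (g : M ⟶ N) :
    f ≫ g ∈ epiIdeal i L hN ↔ f ∈ epiIdeal i L hM ∨ g ∈ epiIdeal i M hN := by
  rw [← not_iff_not, not_or, notMem_epiIdeal, notMem_epiIdeal, notMem_epiIdeal, factorMap_comp]
  constructor
  · rintro ⟨h0, h⟩
    have hg : Function.Surjective (factorMap g i) :=
      Function.Surjective.of_comp (g := factorMap f i) h
    exact ⟨⟨hg.nontrivial, hM.surjective_of_comp h⟩, h0, hg⟩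
  · rintro ⟨⟨-, hf⟩, h0, hg⟩
    exact ⟨h0, hg.comp hf⟩

variable (S n) in
/-- The `2n` completely prime ideals of the category of objects with uniserial factors: `Sum.inl i`
stands for the `i`-th monogeny ideal, `Sum.inr i` for the `i`-th epigeny ideal. -/
def factorIdeals :
    CompletelyPrimeFamily (Subtype.val : UniserialFactors.{v} S n → ChainModule.{v} S n)
      (Fin n ⊕ Fin n) where
  ideal p M N := p.elim (fun i => monoIdeal i (M.2 i) N.1) (fun i => epiIdeal i M.1 (N.2 i))
  comp_mem_iff {p L M N} f g := by
    cases p with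
    | inl i => exact comp_mem_monoIdeal_iff (L.2 i) (M.2 i) f g
    | inr i => exact comp_mem_epiIdeal_iff (M.2 i) (N.2 i) f g
  isIso_of_forall {M} f h := by
    refine isIso_of_bijective_factorMap f fun i => ?_
    rcases subsingleton_or_nontrivial (M.1.Factor i) with h0 | h0
    · exact ⟨fun _ _ _ => Subsingleton.elim _ _, fun y => ⟨0, Subsingleton.elim _ _⟩⟩
    · exact ⟨((notMem_monoIdeal (M.2 i)).1 (h (Sum.inl i) ((id_notMem_monoIdeal (M.2 i)).2 h0))).2,
        ((notMem_epiIdeal (M.2 i)).1 (h (Sum.inr i) ((id_notMem_epiIdeal (M.2 i)).2 h0))).2⟩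

end ideals

end ChainModule

/-! ### Direct sums of objects with uniserial factors -/

theorem theorem5p2 {R : Type u} [Ring R] {n : ℕ} (hn : 0 < n) {r s : ℕ}
    (M : Fin r → ChainModule.{v} Rᵐᵒᵖ n) (N : Fin s → ChainModule.{v} Rᵐᵒᵖ n)
    (hM₀ : ∀ k, Nontrivial (M k).carrier) (hN₀ : ∀ l, Nontrivial (N l).carrier)
    (hM : ∀ k i, IsUniserial Rᵐᵒᵖ ((M k).Factor i))
    (hN : ∀ l i, IsUniserial Rᵐᵒᵖ ((N l).Factor i)) :
    Nonempty (ChainModule.directSum M ≅ ChainModule.directSum N) ↔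
      ∃ φm φe : ∀ i : Fin n,
          ChainModule.nonzeroFactorIndices M i ≃ ChainModule.nonzeroFactorIndices N i,
        (∀ i k, ChainModule.SameMonogenyClass i (M k.1) (N (φm i k).1)) ∧
        (∀ i k, ChainModule.SameEpigenyClass i (M k.1) (N (φe i k).1)) := by
  constructor
  · rintro ⟨e⟩
    choose φm hm using ChainModule.exists_equiv_sameMonogenyClass hM hN
      (ChainModule.directSumBicone M) (ChainModule.sum_directSumBicone M)
      (ChainModule.directSumBicone N) (ChainModule.sum_directSumBicone N) e
    choose φe he using ChainModule.exists_equiv_sameEpigenyClass hM hN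
      (ChainModule.directSumBicone M) (ChainModule.sum_directSumBicone M)
      (ChainModule.directSumBicone N) (ChainModule.sum_directSumBicone N) e
    exact ⟨φm, φe, hm, he⟩
  · rintro ⟨φm, φe, hm, he⟩
    let a : Fin r → ChainModule.UniserialFactors.{v} Rᵐᵒᵖ n := fun k => ⟨M k, hM k⟩
    let b : Fin s → ChainModule.UniserialFactors.{v} Rᵐᵒᵖ n := fun l => ⟨N l, hN l⟩
    let I := ChainModule.factorIdeals.{v} Rᵐᵒᵖ n
    let cm (i : Fin n) : {k // 𝟙 (a k).1 ∉ I.ideal (Sum.inl i) (a k) (a k)} ≃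
        ChainModule.nonzeroFactorIndices M i :=
      Equiv.subtypeEquivRight fun k => ChainModule.id_notMem_monoIdeal (hM k i)
    let dm (i : Fin n) : {l // 𝟙 (b l).1 ∉ I.ideal (Sum.inl i) (b l) (b l)} ≃
        ChainModule.nonzeroFactorIndices N i :=
      Equiv.subtypeEquivRight fun l => ChainModule.id_notMem_monoIdeal (hN l i)
    let ce (i : Fin n) : {k // 𝟙 (a k).1 ∉ I.ideal (Sum.inr i) (a k) (a k)} ≃
        ChainModule.nonzeroFactorIndices M i :=
      Equiv.subtypeEquivRight fun k => ChainModule.id_notMem_epiIdeal (hM k i)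
    let de (i : Fin n) : {l // 𝟙 (b l).1 ∉ I.ideal (Sum.inr i) (b l) (b l)} ≃
        ChainModule.nonzeroFactorIndices N i :=
      Equiv.subtypeEquivRight fun l => ChainModule.id_notMem_epiIdeal (hN l i)
    let φ (p : Fin n ⊕ Fin n) : {k // 𝟙 (a k).1 ∉ I.ideal p (a k) (a k)} ≃
        {l // 𝟙 (b l).1 ∉ I.ideal p (b l) (b l)} :=
      match p with
      | Sum.inl i => (cm i).trans ((φm i).trans (dm i).symm)
      | Sum.inr i => (ce i).trans ((φe i).trans (de i).symm)
    refine I.nonempty_iso_of_equiv (a := a) (b := b) (ChainModule.directSumBicone M)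
      (ChainModule.sum_directSumBicone M) (ChainModule.directSumBicone N)
      (ChainModule.sum_directSumBicone N) φ ?_
    rintro (i | i) k
    · obtain ⟨f, g, hf, hg⟩ := hm i (cm i k)
      exact ⟨f, g, (ChainModule.notMem_monoIdeal (hM k i)).2 ⟨(cm i k).2, hf⟩,
        (ChainModule.notMem_monoIdeal (hN _ i)).2 ⟨(φm i (cm i k)).2, hg⟩⟩
    · obtain ⟨f, g, hf, hg⟩ := he i (ce i k)
      exact ⟨f, g, (ChainModule.notMem_epiIdeal (hN _ i)).2 ⟨(φe i (ce i k)).2, hf⟩,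
        (ChainModule.notMem_epiIdeal (hM k i)).2 ⟨(ce i k).2, hg⟩⟩
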